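/- A two-way quantum finite automaton with restart (2QFA$^{\circlearrowleft}$) over an input alphabet $\Sigma$ has a finite state set $Q$, an initial state $q_0\in Q$, a partition of $Q$ into nonhalting states (among them $q_0$), accepting states, rejecting states and restart states, and transition amplitudes $\delta(q,\sigma,q',d)\in\mathbb C$ for $q,q'\in Q$, $\sigma\in\Sigma\cup\{¢,\$\}$ and head moves $d\in\{-1,0,1\}$. On input $w\in\Sigma^*$ the tape contains $¢w\$$, with its squares indexed by $\mathbb Z_{|w|+2}$, and for every $w$ the operator $U_\delta^w$ on $\ell_2(Q\times\mathbb Z_{|w|+2})$ induced by $\delta$ is required to be unitary. The machine starts in the configuration $(q_0,0)$. In each step $U_\delta^w$ is applied, and then it is measured whether the state is accepting, rejecting, nonhalting or restart: in the first two cases the machine halts with that answer; in the third it continues from the normalized projection onto the nonhalting configurations; in the fourth it continues from $(q_0,0)$. A round is a segment of computation from a (re)start up to the next halting or restart outcome. It is assumed that, for each input, every round ends with probability $1$ within a bounded number of steps. **Theorem.** There are constants $n\in\mathbb N$ and $C\in\mathbb R$ such that for every real $\varepsilon>0$ there is an $n$-state 2QFA$^{\circlearrowleft}$ $M_\varepsilon$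 over $\{a,b\}$ which recognizes $L_{eq}=\{a^kb^k\mid k\ge 0\}$ with one-sided error bound $\varepsilon$, that is, $M_\varepsilon$ accepts every $w\in L_{eq}$ with probability $1$ and rejects every $w\in\{a,b\}^*\setminus L_{eq}$ with probability at least $1-\varepsilon$, and whose expected number of steps on every input $w\in\{a,b\}^*$ is at most $C\cdot\max\{1,\tfrac1\varepsilon\}\cdot(|w|+1)$, i.e. $O(\tfrac1\varepsilon|w|)$. -/

import Mathlib

/-- Tape symbols: the left end-marker, the input symbols, the right end-marker. -/
inductive TapeSymbol (A : Type*) where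
  | leftEnd : TapeSymbol A
  | letter (x : A) : TapeSymbol A
  | rightEnd : TapeSymbol A

/-- Head movements: one square to the left, none, one square to the right. -/
inductive HeadMove where
  | left | stay | right
  deriving DecidableEq

instance : Fintype HeadMove where
  elems := {.left, .stay, .right}
  complete := by intro d; cases d <;> simp

/-- The role of a state: nonhalting and nonresetting, accepting, rejecting, or
"reset the head to the left end-marker and continue in state `target`". -/
inductive StateRole (Q : Type*) where
  | non : StateRole Q
  | acc : StateRole Q
  | rej : StateRole Q
  | reset (target : Q) : StateRole Q
  deriving DecidableEq

/-- The tape contents on input `w`: the word `w` between the two end-markers. -/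
def tapeOf {A : Type*} (w : List A) (i : Fin (w.length + 2)) : TapeSymbol A :=
  (TapeSymbol.leftEnd :: (w.map TapeSymbol.letter ++ [TapeSymbol.rightEnd]))[(i : ℕ)]'(by
    have := i.isLt
    simp only [List.length_cons, List.length_append, List.length_map, List.length_nil]
    omega)

/-- The new head position; the tape squares are indexed by the integers modulo `k + 2`. -/
def HeadMove.apply {k : ℕ} (d : HeadMove) (i : Fin (k + 2)) : Fin (k + 2) :=
  match d with
  | .left => i - 1
  | .stay => i
  | .right => i + 1

/-- Configurations on input `w`: pairs (state, head position). -/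
abbrev QConfig (Q : Type*) {A : Type*} (w : List A) : Type _ := Q × Fin (w.length + 2)

/-- The time-evolution operator induced on the configuration space by a transition function `δ`,
where `δ q σ q' d` is the amplitude of going from state `q` scanning `σ` to state `q'` while
moving the head by `d`. The column of a configuration `c` is the image of the basis vector `|c⟩`. -/
def evolutionMatrix {Q A : Type*} (δ : Q → TapeSymbol A → Q → HeadMove → ℂ) (w : List A) :
    Matrix (QConfig Q w) (QConfig Q w) ℂ :=
  Matrix.of fun c' c =>
    ∑ d : HeadMove, if d.apply c.2 = c'.2 then δ c.1 (tapeOf w c.2) c'.1 d else 0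

/-- Two-way quantum finite automata with reset, with state set `Q` and input alphabet `A`. -/
structure TwoWayQFAReset (Q A : Type*) [Fintype Q] [DecidableEq Q] where
  /-- transition amplitudes -/
  δ : Q → TapeSymbol A → Q → HeadMove → ℂ
  /-- initial state -/
  start : Q
  /-- the partition of the states into nonhalting, accepting, rejecting and reset states -/
  role : Q → StateRole Q
  start_non : role start = .non
  target_non : ∀ p q : Q, role p = .reset q → role q = .non
  unitary : ∀ w : List A, evolutionMatrix δ w ∈ Matrix.unitaryGroup (QConfig Q w) ℂ

namespace TwoWayQFAReset

variable {Q A : Type*} [Fintype Q] [DecidableEq Q]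

/-- A two-way QFA with restart: all resets go to the initial state. -/
def IsRestart (M : TwoWayQFAReset Q A) : Prop :=
  ∀ p q : Q, M.role p = .reset q → q = M.start

/-- The unitary half of a step, acting on density matrices. -/
def evolve (M : TwoWayQFAReset Q A) (w : List A) (ρ : Matrix (QConfig Q w) (QConfig Q w) ℂ) :
    Matrix (QConfig Q w) (QConfig Q w) ℂ :=
  evolutionMatrix M.δ w * ρ * (evolutionMatrix M.δ w).conjTranspose

/-- The probability that measuring the role of the current state yields the outcome `r`. -/
def outcomeProb (M : TwoWayQFAReset Q A) {w : List A}
    (ρ : Matrix (QConfig Q w) (QConfig Q w) ℂ) (r : StateRole Q) : ℝ :=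
  ∑ c : QConfig Q w, if M.role c.1 = r then (ρ c c).re else 0

/-- The part of the (mixed) state that survives the measurement. The outcome "continue" leaves the
projection onto the nonhalting configurations, the outcome "reset with state `q`" leaves the
configuration `(q, 0)`, and the two halting outcomes end the computation. States are not
renormalized: the trace is the probability of having reached this point. -/
def afterMeasurement (M : TwoWayQFAReset Q A) {w : List A}
    (ρ : Matrix (QConfig Q w) (QConfig Q w) ℂ) : Matrix (QConfig Q w) (QConfig Q w) ℂ :=
  (Matrix.of fun c c' => if M.role c.1 = .non ∧ M.role c'.1 = .non then ρ c c' else 0) +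
    ∑ q : Q, Matrix.single (q, 0) (q, 0) ((M.outcomeProb ρ (.reset q) : ℝ) : ℂ)

/-- The unnormalized mixed state of the computations on `w` that have not halted within the first
`t` steps. -/
def stateAt (M : TwoWayQFAReset Q A) (w : List A) : ℕ → Matrix (QConfig Q w) (QConfig Q w) ℂ
  | 0 => Matrix.single (M.start, 0) (M.start, 0) 1
  | t + 1 => M.afterMeasurement (M.evolve w (M.stateAt w t))

/-- The overall probability that `w` is accepted. -/
noncomputable def acceptProb (M : TwoWayQFAReset Q A) (w : List A) : ENNReal :=
  ∑' t : ℕ, ENNReal.ofReal (M.outcomeProb (M.evolve w (M.stateAt w t)) .acc)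

/-- The overall probability that `w` is rejected. -/
noncomputable def rejectProb (M : TwoWayQFAReset Q A) (w : List A) : ENNReal :=
  ∑' t : ℕ, ENNReal.ofReal (M.outcomeProb (M.evolve w (M.stateAt w t)) .rej)

/-- The expected number `∑ₜ Pr[T > t]` of steps before halting on `w`, where `T` is the (possibly
infinite) number of steps made, over all rounds. -/
noncomputable def expectedTime (M : TwoWayQFAReset Q A) (w : List A) : ENNReal :=
  ∑' t : ℕ, ENNReal.ofReal (M.stateAt w t).trace.re

/-- The unnormalized superposition of a round on `w` that starts in the configuration `(q, 0)` and
has neither halted nor reset within its first `t` steps. -/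
def roundAt (M : TwoWayQFAReset Q A) (w : List A) (q : Q) : ℕ → QConfig Q w → ℂ
  | 0 => Pi.single (q, 0) 1
  | t + 1 => fun c =>
      if M.role c.1 = .non then (evolutionMatrix M.δ w).mulVec (M.roundAt w q t) c else 0

/-- There are no infinite loops within a round: for every input there is a number of steps by which
a round has, with probability one, ended by halting or resetting. -/
def RoundsTerminate (M : TwoWayQFAReset Q A) : Prop :=
  ∀ (w : List A) (q : Q), (q = M.start ∨ ∃ p : Q, M.role p = .reset q) →
    ∃ t : ℕ, M.roundAt w q t = 0

/-- `M` recognizes `L` with (negative) one-sided error bound `ε`. -/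
def RecognizesOneSided (M : TwoWayQFAReset Q A) (L : Language A) (ε : ℝ) : Prop :=
  (∀ w ∈ L, M.acceptProb w = 1) ∧ ∀ w ∉ L, ENNReal.ofReal (1 - ε) ≤ M.rejectProb w

end TwoWayQFAReset

/-- The input alphabet `{a, b}`. -/
inductive LetterAB where
  | a | b
  deriving DecidableEq

/-- The language `{aᵏ bᵏ | k ≥ 0}`. -/
def Leq : Language LetterAB :=
  {w | ∃ k : ℕ, w = List.replicate k LetterAB.a ++ List.replicate k LetterAB.b}

/-! A round first checks deterministically that the input is `aⁱbʲ`, rejecting otherwise. At the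
right end-marker it splits into two paths of amplitude `1/√2` that run back to the left; one pauses
a step on every `a`, the other on every `b`, so they arrive at the left end-marker simultaneously
exactly when `i = j`. There a Hadamard-type reflection is applied. Simultaneous paths interfere: the
rejecting amplitude cancels, and the round accepts with probability `e` and restarts with
probability `1 - e`. Paths arriving at different times cannot interfere, and each contributes
probabilities `e/4`, `1/4`, `(1-e)/4` of accepting, rejecting and restarting.

Rounds are independent repetitions, so overall probabilities are ratios. Members are accepted with
probability `e / (1 - (1-e)) = 1`; words `aⁱbʲ` with `i ≠ j` are rejected with probability `(1/2) /
(1 - (1-e)/2) = 1/(1+e) ≥ 1 - e`. A round takes `O(|w|)` steps and at most `2/e` rounds are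
expected.

The repetition argument rests on `stateAt_eq_sum` and `tsum_renewal`; the quantum content is in
`endsRound_together`, `endsRound_goA_first` and `endsRound_goB_first`; `chain_goA` and `chain_goB`
supply the arrival times. -/

/-! ### Unitarity from one local matrix per tape symbol -/

/-- The transition function of an automaton whose head movements are determined by the state
entered. -/
def headedTransition {Q A : Type*} (D : Q → HeadMove) (V : TapeSymbol A → Matrix Q Q ℂ)
    (q : Q) (σ : TapeSymbol A) (q' : Q) (d : HeadMove) : ℂ :=
  if D q' = d then V σ q' q else 0

lemma HeadMove.apply_bijective {k : ℕ} (d : HeadMove) :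
    Function.Bijective (d.apply : Fin (k + 2) → Fin (k + 2)) := by
  cases d
  · exact (Equiv.subRight (1 : Fin (k + 2))).bijective
  · exact Function.bijective_id
  · exact (Equiv.addRight (1 : Fin (k + 2))).bijective

lemma evolutionMatrix_headedTransition {Q A : Type*} (D : Q → HeadMove)
    (V : TapeSymbol A → Matrix Q Q ℂ) (w : List A) (c' c : QConfig Q w) :
    evolutionMatrix (headedTransition D V) w c' c =
      if (D c'.1).apply c.2 = c'.2 then V (tapeOf w c.2) c'.1 c.1 else 0 := by
  simp only [evolutionMatrix, headedTransition, Matrix.of_apply]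
  rw [Finset.sum_eq_single (D c'.1)]
  · simp
  · intro d _ hd
    simp [hd.symm]
  · simp

/-- Entries in rows `(q, i)` and `(q', i')` overlap only at a source square `j` that both head moves
carry to the right place, and there the sum over states is an inner product of rows of `V σ`. It
vanishes for `q ≠ q'`; for `q = q'` bijectivity of the cyclic shift forces `i = i'` and leaves one
`j`. -/
lemma headedTransition_unitary {Q A : Type*} [Fintype Q] [DecidableEq Q] (D : Q → HeadMove)
    (V : TapeSymbol A → Matrix Q Q ℂ) (hV : ∀ σ, V σ ∈ Matrix.unitaryGroup Q ℂ) (w : List A) :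
    evolutionMatrix (headedTransition D V) w ∈ Matrix.unitaryGroup (QConfig Q w) ℂ := by
  rw [Matrix.mem_unitaryGroup_iff]
  have hV' : ∀ σ q q', ∑ p, V σ q p * star (V σ q' p) = if q = q' then 1 else 0 := by
    intro σ q q'
    have h := congrFun (congrFun (Matrix.mem_unitaryGroup_iff.mp (hV σ)) q) q'
    rwa [Matrix.mul_apply, Matrix.one_apply] at h
  ext ⟨q, i⟩ ⟨q', i'⟩
  rw [Matrix.mul_apply, Fintype.sum_prod_type_right]
  have h : ∀ j, ∑ p, evolutionMatrix (headedTransition D V) w (q, i) (p, j) *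
      star (evolutionMatrix (headedTransition D V) w) (p, j) (q', i') =
      if (D q).apply j = i ∧ (D q').apply j = i' ∧ q = q' then 1 else 0 := by
    intro j
    simp only [Matrix.star_apply, evolutionMatrix_headedTransition]
    by_cases h1 : (D q).apply j = i <;> by_cases h2 : (D q').apply j = i' <;> simp [h1, h2]
    simpa using hV' (tapeOf w j) q q'
  simp only [h, Matrix.one_apply, Prod.mk.injEq]
  by_cases hq : q = q'
  · subst hq
    obtain ⟨j, rfl⟩ := (D q).apply_bijective.2 i
    simp only [and_true, true_and]
    rw [Finset.sum_eq_single j]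
    · simp
    · intro j' _ hj
      rw [if_neg]
      exact fun hh => hj ((D q).apply_bijective.1 hh.1)
    · simp
  · simp [hq]

/-- The amplitudes over states, spread over the configurations reached from head position `i`. -/
def spread {Q : Type*} {k : ℕ} (D : Q → HeadMove) (i : Fin (k + 2)) (v : Q → ℂ) :
    Q × Fin (k + 2) → ℂ :=
  fun c => if (D c.1).apply i = c.2 then v c.1 else 0

lemma spread_single {Q : Type*} [DecidableEq Q] {k : ℕ} (D : Q → HeadMove) (i : Fin (k + 2))
    (q : Q) (z : ℂ) :
    spread D i (Pi.single q z) = Pi.single (q, (D q).apply i) z := by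
  ext ⟨p, j⟩
  by_cases hp : p = q
  · subst hp
    by_cases hj : (D p).apply i = j
    · subst hj; simp [spread]
    · have : (p, j) ≠ (p, (D p).apply i) := fun h => hj (congrArg Prod.snd h).symm
      simp [spread, hj, this]
  · have : (p, j) ≠ (q, (D q).apply i) := fun h => hp (congrArg Prod.fst h)
    simp [spread, hp, this]

lemma spread_add {Q : Type*} {k : ℕ} (D : Q → HeadMove) (i : Fin (k + 2)) (u v : Q → ℂ) :
    spread D i (u + v) = spread D i u + spread D i v := by
  ext c
  simp only [spread, Pi.add_apply]
  split_ifs <;> simp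

lemma evolutionMatrix_headedTransition_mulVec_single {Q A : Type*} [Fintype Q] [DecidableEq Q]
    (D : Q → HeadMove) (V : TapeSymbol A → Matrix Q Q ℂ) (w : List A) (q : Q)
    (i : Fin (w.length + 2)) (z : ℂ) :
    (evolutionMatrix (headedTransition D V) w).mulVec (Pi.single (q, i) z) =
      spread D i ((V (tapeOf w i)).mulVec (Pi.single q z)) := by
  ext c
  rw [Matrix.mulVec_single, spread, Matrix.mulVec_single]
  simp [evolutionMatrix_headedTransition]

/-! ### Plane reflections and permutations of basis states -/

/-- The reflection acting on the span of the basis vectors `i` and `j` by the matrix with rows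
`(s, c)` and `(c, -s)`, and fixing the other basis vectors. -/
def planeReflection {Q : Type*} [DecidableEq Q] (i j : Q) (s c : ℝ) : Matrix Q Q ℂ :=
  Matrix.of fun k l =>
    if k = i then (if l = i then (s : ℂ) else if l = j then (c : ℂ) else 0)
    else if k = j then (if l = i then (c : ℂ) else if l = j then (-s : ℂ) else 0)
    else if k = l then 1 else 0

section planeReflection

variable {Q : Type*} [Fintype Q] [DecidableEq Q] {i j : Q} (hij : i ≠ j) (s c : ℝ)

include hij

lemma planeReflection_mulVec_left (z : ℂ) :
    (planeReflection i j s c).mulVec (Pi.single i z) =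
      Pi.single i (s * z) + Pi.single j (c * z) := by
  ext k
  rw [Matrix.mulVec_single]
  by_cases hk : k = i
  · subst hk; simp [planeReflection, hij, mul_comm]
  · by_cases hk' : k = j
    · subst hk'; simp [planeReflection, hij.symm, mul_comm]
    · simp [planeReflection, hk, hk']

lemma planeReflection_mulVec_right (z : ℂ) :
    (planeReflection i j s c).mulVec (Pi.single j z) =
      Pi.single i (c * z) + Pi.single j (-s * z) := by
  ext k
  rw [Matrix.mulVec_single]
  by_cases hk : k = i
  · subst hk; simp [planeReflection, hij, hij.symm, mul_comm]
  · by_cases hk' : k = j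
    · subst hk'; simp [planeReflection, hij.symm, mul_comm]
    · simp [planeReflection, hk, hk']

omit hij in
lemma planeReflection_mulVec_of_ne {l : Q} (hi : l ≠ i) (hj : l ≠ j) (z : ℂ) :
    (planeReflection i j s c).mulVec (Pi.single l z) = Pi.single l z := by
  ext k
  rw [Matrix.mulVec_single]
  by_cases hk : k = i
  · subst hk; simp [planeReflection, hi, hi.symm, hj]
  · by_cases hk' : k = j
    · subst hk'; simp [planeReflection, hj.symm, hi, hj]
    · by_cases hl : k = l
      · subst hl; simp [planeReflection, hk, hk']
      · simp [planeReflection, hk, hk', hl]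

/-- The matrix is real symmetric, and it squares to the identity because `s² + c² = 1`. -/
lemma planeReflection_unitary (hsc : s ^ 2 + c ^ 2 = 1) :
    planeReflection i j s c ∈ Matrix.unitaryGroup Q ℂ := by
  have hsc' : (s : ℂ) * s + c * c = 1 := by
    rw [← pow_two, ← pow_two]; exact_mod_cast hsc
  have hstar : star (planeReflection i j s c) = planeReflection i j s c := by
    ext k l
    rw [Matrix.star_apply]
    by_cases hki : k = i <;> by_cases hkj : k = j <;> by_cases hli : l = i <;>
      by_cases hlj : l = j <;> by_cases hkl : k = l <;>
      simp_all [planeReflection, eq_comm]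
  rw [Matrix.mem_unitaryGroup_iff, hstar]
  refine Matrix.ext_of_mulVec_single fun l => ?_
  rw [← Matrix.mulVec_mulVec, Matrix.one_mulVec]
  by_cases hi : l = i
  · subst hi
    rw [planeReflection_mulVec_left hij, Matrix.mulVec_add, planeReflection_mulVec_left hij,
      planeReflection_mulVec_right hij, add_add_add_comm, ← Pi.single_add, ← Pi.single_add]
    rw [show (s : ℂ) * (s * 1) + c * (c * 1) = 1 by linear_combination hsc',
      show (c : ℂ) * (s * 1) + -s * (c * 1) = 0 by ring]
    simp
  · by_cases hj : l = j
    · subst hj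
      rw [planeReflection_mulVec_right hij, Matrix.mulVec_add, planeReflection_mulVec_left hij,
        planeReflection_mulVec_right hij, add_add_add_comm, ← Pi.single_add, ← Pi.single_add]
      rw [show (s : ℂ) * (c * 1) + c * (-s * 1) = 0 by ring,
        show (c : ℂ) * (c * 1) + -s * (-s * 1) = 1 by linear_combination hsc']
      simp
    · rw [planeReflection_mulVec_of_ne s c hi hj, planeReflection_mulVec_of_ne s c hi hj]

end planeReflection

/-- The matrix sending the basis vector `i` to the basis vector `π i`. -/
def permutationOperator {Q : Type*} [DecidableEq Q] (π : Equiv.Perm Q) : Matrix Q Q ℂ :=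
  Matrix.of fun k l => if k = π l then 1 else 0

lemma permutationOperator_mulVec {Q : Type*} [Fintype Q] [DecidableEq Q] (π : Equiv.Perm Q)
    (q : Q) (z : ℂ) :
    (permutationOperator π).mulVec (Pi.single q z) = Pi.single (π q) z := by
  ext k
  rw [Matrix.mulVec_single]
  by_cases h : k = π q
  · subst h; simp [permutationOperator]
  · simp [permutationOperator, h]

lemma permutationOperator_unitary {Q : Type*} [Fintype Q] [DecidableEq Q] (π : Equiv.Perm Q) :
    permutationOperator π ∈ Matrix.unitaryGroup Q ℂ := by
  rw [Matrix.mem_unitaryGroup_iff']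
  ext k l
  simp [Matrix.mul_apply, permutationOperator, Matrix.one_apply, eq_comm]

/-! ### Decomposition of the mixed state into rounds -/

namespace TwoWayQFAReset

variable {Q A : Type*} [Fintype Q] [DecidableEq Q]

/-- The probability of the outcome `r` on measuring the unnormalized pure state `v`. -/
def pureProb (M : TwoWayQFAReset Q A) {w : List A} (v : QConfig Q w → ℂ) (r : StateRole Q) : ℝ :=
  ∑ c : QConfig Q w, if M.role c.1 = r then Complex.normSq (v c) else 0

/-- One step of a round: the evolution followed by the projection onto nonhalting states. -/
def roundStep (M : TwoWayQFAReset Q A) (w : List A) (v : QConfig Q w → ℂ) : QConfig Q w → ℂ :=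
  fun c => if M.role c.1 = .non then (evolutionMatrix M.δ w).mulVec v c else 0

/-- The density matrix of an unnormalized pure state. -/
def pureState {ι : Type*} (v : ι → ℂ) : Matrix ι ι ℂ := Matrix.vecMulVec v (star v)

lemma roundAt_eq_iterate (M : TwoWayQFAReset Q A) (w : List A) (q : Q) (t : ℕ) :
    M.roundAt w q t = (M.roundStep w)^[t] (Pi.single (q, 0) 1) := by
  induction t with
  | zero => rfl
  | succ t ih => rw [Function.iterate_succ_apply', ← ih]; rfl

lemma pureProb_nonneg (M : TwoWayQFAReset Q A) {w : List A} (v : QConfig Q w → ℂ)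
    (r : StateRole Q) : 0 ≤ M.pureProb v r :=
  Finset.sum_nonneg fun c _ => by split_ifs <;> simp [Complex.normSq_nonneg]

lemma evolve_pureState (M : TwoWayQFAReset Q A) (w : List A) (v : QConfig Q w → ℂ) :
    M.evolve w (pureState v) = pureState ((evolutionMatrix M.δ w).mulVec v) := by
  rw [evolve, pureState, pureState, Matrix.mul_vecMulVec, Matrix.vecMulVec_mul, Matrix.star_mulVec]

lemma outcomeProb_pureState (M : TwoWayQFAReset Q A) {w : List A} (v : QConfig Q w → ℂ)
    (r : StateRole Q) : M.outcomeProb (pureState v) r = M.pureProb v r := by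
  refine Finset.sum_congr rfl fun c _ => ?_
  simp [pureState, Matrix.vecMulVec_apply, Complex.mul_conj]

lemma evolve_sum (M : TwoWayQFAReset Q A) (w : List A) {ι : Type*} (s : Finset ι) (r : ι → ℝ)
    (ρ : ι → Matrix (QConfig Q w) (QConfig Q w) ℂ) :
    M.evolve w (∑ i ∈ s, r i • ρ i) = ∑ i ∈ s, r i • M.evolve w (ρ i) := by
  simp [evolve, Matrix.mul_sum, Matrix.sum_mul]

lemma outcomeProb_sum (M : TwoWayQFAReset Q A) {w : List A} {ι : Type*} (s : Finset ι) (r : ι → ℝ)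
    (ρ : ι → Matrix (QConfig Q w) (QConfig Q w) ℂ) (o : StateRole Q) :
    M.outcomeProb (∑ i ∈ s, r i • ρ i) o = ∑ i ∈ s, r i * M.outcomeProb (ρ i) o := by
  simp only [outcomeProb, Finset.mul_sum]
  rw [Finset.sum_comm]
  refine Finset.sum_congr rfl fun c _ => ?_
  split_ifs
  · simp [Matrix.sum_apply]
  · simp

/-- The probability that a round starts at time `t`. -/
def restartProb (M : TwoWayQFAReset Q A) (w : List A) : ℕ → ℝ
  | 0 => 1
  | t + 1 => M.outcomeProb (M.evolve w (M.stateAt w t)) (.reset M.start)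

lemma afterMeasurement_of_isRestart {M : TwoWayQFAReset Q A} (hM : M.IsRestart) {w : List A}
    (ρ : Matrix (QConfig Q w) (QConfig Q w) ℂ) :
    M.afterMeasurement ρ =
      (Matrix.of fun c c' => if M.role c.1 = .non ∧ M.role c'.1 = .non then ρ c c' else 0) +
        M.outcomeProb ρ (.reset M.start) • pureState (Pi.single (M.start, 0) 1) := by
  rw [afterMeasurement, Finset.sum_eq_single M.start]
  · congr 1
    ext c c'
    by_cases h : c = (M.start, 0) <;> by_cases h' : c' = (M.start, 0) <;>
      simp [pureState, Matrix.vecMulVec_apply, h, h', eq_comm]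
  · intro q _ hq
    have : M.outcomeProb ρ (.reset q) = 0 := by
      refine Finset.sum_eq_zero fun c _ => if_neg fun h => hq (hM _ _ h)
    simp [this]
  · simp

/-- Condition on the time of the last restart. A restart is a measured outcome that always leaves
the same basis state, so the state is a mixture of pure states of rounds of different ages, without
coherence between rounds. -/
lemma stateAt_eq_sum {M : TwoWayQFAReset Q A} (hM : M.IsRestart) (w : List A) (t : ℕ) :
    M.stateAt w t = ∑ x ∈ Finset.HasAntidiagonal.antidiagonal t,
      M.restartProb w x.1 • pureState (M.roundAt w M.start x.2) := by
  induction t with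
  | zero =>
    ext c c'
    by_cases h : c = (M.start, 0) <;> by_cases h' : c' = (M.start, 0) <;>
      simp [stateAt, restartProb, roundAt, pureState, Matrix.vecMulVec_apply, h, h', eq_comm]
  | succ t ih =>
    -- The split-off term, of age `0`, is the round restarted just now; all other rounds grow one
    -- step older.
    rw [Finset.Nat.antidiagonal_succ', Finset.sum_cons, stateAt, afterMeasurement_of_isRestart hM,
      add_comm]
    congr 1
    rw [ih, evolve_sum, Finset.sum_map]
    simp only [evolve_pureState]
    ext c c'
    by_cases h : M.role c.1 = .non <;> by_cases h' : M.role c'.1 = .non <;>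
      simp [h, h', Matrix.sum_apply, pureState, Matrix.vecMulVec_apply, roundAt]

end TwoWayQFAReset

/-! ### Convolutions and the renewal equation -/

open scoped ENNReal in
lemma tsum_antidiagonal_mul (f g : ℕ → ℝ≥0∞) :
    ∑' t, ∑ x ∈ Finset.HasAntidiagonal.antidiagonal t, f x.1 * g x.2 =
      (∑' i, f i) * ∑' j, g j := by
  have h : ∀ t, ∑ x ∈ Finset.HasAntidiagonal.antidiagonal t, f x.1 * g x.2 =
      ∑' x : Finset.HasAntidiagonal.antidiagonal t, f x.1.1 * g x.1.2 := fun t => by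
    rw [tsum_fintype, ← Finset.sum_coe_sort]
  simp only [h]
  rw [← ENNReal.tsum_sigma' (f := fun p : Σ t : ℕ, Finset.HasAntidiagonal.antidiagonal t =>
      f p.2.1.1 * g p.2.1.2)]
  refine (Finset.HasAntidiagonal.sigmaAntidiagonalEquivProd.tsum_eq
    (fun p : ℕ × ℕ => f p.1 * g p.2)).trans ?_
  rw [ENNReal.tsum_prod (f := fun i j => f i * g j)]
  simp [ENNReal.tsum_mul_left, ENNReal.tsum_mul_right]

open scoped ENNReal in
/-- The expected number of renewals, when `c t` is the probability that the time to the next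
renewal is `t + 1`. -/
lemma tsum_renewal {r c : ℕ → ℝ≥0∞} (h0 : r 0 = 1)
    (hs : ∀ t, r (t + 1) = ∑ x ∈ Finset.HasAntidiagonal.antidiagonal t, r x.1 * c x.2)
    (hr : ∀ t, r t ≠ ∞) (hc : ∑' t, c t < 1) : ∑' t, r t = (1 - ∑' t, c t)⁻¹ := by
  set C := ∑' t, c t
  have hC : C ≠ ∞ := (hc.trans ENNReal.one_lt_top).ne
  have hC' : 1 - C ≠ 0 := (tsub_pos_of_lt hc).ne'
  have hpartial : ∀ n, ∑ t ∈ Finset.range n, r t ≤ (1 - C)⁻¹ := by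
    intro n
    set S := ∑ t ∈ Finset.range n, r t with hSdef
    have hS : S ≠ ∞ := ENNReal.sum_ne_top.2 fun t _ => hr t
    -- Finiteness of the full sum is not yet known, so the renewal equation is first used on partial
    -- sums, which are finite and can be subtracted.
    have h1 : S ≤ 1 + S * C := by
      have hle : S ≤ ∑ t ∈ Finset.range (n + 1), r t :=
        Finset.sum_le_sum_of_subset (Finset.range_mono (Nat.le_succ n))
      refine hle.trans ?_
      rw [Finset.sum_range_succ', h0, add_comm]
      gcongr
      have hS' : S = ∑' t, if t < n then r t else 0 := by
        rw [tsum_eq_sum (s := Finset.range n)]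
        · exact Finset.sum_congr rfl fun t ht => (if_pos (Finset.mem_range.1 ht)).symm
        · intro t ht
          exact if_neg fun h => ht (Finset.mem_range.2 h)
      rw [hS', ← tsum_antidiagonal_mul]
      refine le_trans (Finset.sum_le_sum fun t ht => ?_) (ENNReal.sum_le_tsum (Finset.range n))
      rw [hs]
      refine Finset.sum_le_sum fun x hx => ?_
      rw [if_pos]
      have := Finset.HasAntidiagonal.mem_antidiagonal.1 hx
      have := Finset.mem_range.1 ht
      omega
    rw [ENNReal.le_inv_iff_mul_le, ENNReal.mul_sub (fun _ _ => hS), mul_one]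
    exact tsub_le_iff_right.2 h1
  have hle : ∑' t, r t ≤ (1 - C)⁻¹ := by
    rw [ENNReal.tsum_eq_iSup_nat]
    exact iSup_le hpartial
  have hR : ∑' t, r t ≠ ∞ := (hle.trans_lt (ENNReal.inv_lt_top.2 (pos_iff_ne_zero.2 hC'))).ne
  -- The full sum is now finite, so `R = 1 + R * C` can be solved for `R`.
  have hrec : ∑' t, r t = 1 + (∑' t, r t) * C := by
    conv_lhs => rw [tsum_eq_zero_add' ENNReal.summable, h0]
    simp only [hs, tsum_antidiagonal_mul, C]
  apply ENNReal.eq_inv_of_mul_eq_one_left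
  rw [ENNReal.mul_sub (fun _ _ => hR), mul_one]
  conv_lhs => rw [hrec]
  rw [← hrec]
  exact ENNReal.sub_eq_of_eq_add (ENNReal.mul_ne_top hR hC) hrec

/-! ### From the statistics of one round to the whole computation -/

namespace TwoWayQFAReset

variable {Q A : Type*} [Fintype Q] [DecidableEq Q]

/-- The squared norm of an amplitude vector. -/
def sqNorm {ι : Type*} [Fintype ι] (v : ι → ℂ) : ℝ := ∑ i, Complex.normSq (v i)

lemma sqNorm_nonneg {ι : Type*} [Fintype ι] (v : ι → ℂ) : 0 ≤ sqNorm v :=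
  Finset.sum_nonneg fun _ _ => Complex.normSq_nonneg _

lemma sqNorm_eq_dotProduct {ι : Type*} [Fintype ι] (v : ι → ℂ) :
    ((sqNorm v : ℝ) : ℂ) = star v ⬝ᵥ v := by
  simp [sqNorm, dotProduct, Complex.normSq_eq_conj_mul_self]

lemma sqNorm_mulVec_of_unitary {ι : Type*} [Fintype ι] [DecidableEq ι] {U : Matrix ι ι ℂ}
    (hU : U ∈ Matrix.unitaryGroup ι ℂ) (v : ι → ℂ) : sqNorm (U.mulVec v) = sqNorm v := by
  have h : ((sqNorm (U.mulVec v) : ℝ) : ℂ) = sqNorm v := by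
    rw [sqNorm_eq_dotProduct, sqNorm_eq_dotProduct, Matrix.star_mulVec, Matrix.dotProduct_mulVec,
      Matrix.vecMul_vecMul, ← Matrix.star_eq_conjTranspose, Matrix.mem_unitaryGroup_iff'.1 hU,
      Matrix.vecMul_one]
  exact_mod_cast h

lemma sqNorm_roundAt_le_one (M : TwoWayQFAReset Q A) (w : List A) (q : Q) (t : ℕ) :
    sqNorm (M.roundAt w q t) ≤ 1 := by
  induction t with
  | zero =>
    rw [sqNorm, Finset.sum_eq_single (q, 0)]
    · simp [roundAt]
    · intro c _ hc
      simp [roundAt, hc]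
    · simp
  | succ t ih =>
    refine le_trans ?_ ((sqNorm_mulVec_of_unitary (M.unitary w) _).trans_le ih)
    refine Finset.sum_le_sum fun c _ => ?_
    simp only [roundAt]
    split_ifs
    · exact le_rfl
    · simp [Complex.normSq_nonneg]

/-- The probability that a round ends with outcome `r` at step `t`. -/
def roundProb (M : TwoWayQFAReset Q A) (w : List A) (r : StateRole Q) (t : ℕ) : ℝ :=
  M.pureProb ((evolutionMatrix M.δ w).mulVec (M.roundAt w M.start t)) r

lemma roundProb_nonneg (M : TwoWayQFAReset Q A) (w : List A) (r : StateRole Q) (t : ℕ) :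
    0 ≤ M.roundProb w r t := M.pureProb_nonneg _ _

section IsRestart

variable {M : TwoWayQFAReset Q A} (hM : M.IsRestart) (w : List A)

include hM

lemma outcomeProb_stateAt (r : StateRole Q) (t : ℕ) :
    M.outcomeProb (M.evolve w (M.stateAt w t)) r =
      ∑ x ∈ Finset.HasAntidiagonal.antidiagonal t,
        M.restartProb w x.1 * M.roundProb w r x.2 := by
  rw [stateAt_eq_sum hM, evolve_sum, outcomeProb_sum]
  simp only [evolve_pureState, outcomeProb_pureState, roundProb]

lemma trace_stateAt (t : ℕ) :
    (M.stateAt w t).trace.re = ∑ x ∈ Finset.HasAntidiagonal.antidiagonal t,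
      M.restartProb w x.1 * sqNorm (M.roundAt w M.start x.2) := by
  rw [stateAt_eq_sum hM, Matrix.trace_sum, Complex.re_sum]
  refine Finset.sum_congr rfl fun x _ => ?_
  rw [Matrix.trace_smul, pureState, Matrix.trace_vecMulVec, dotProduct_comm,
    ← sqNorm_eq_dotProduct]
  simp

lemma restartProb_nonneg (t : ℕ) : 0 ≤ M.restartProb w t := by
  induction t using Nat.strong_induction_on with
  | _ t ih =>
    cases t with
    | zero => exact zero_le_one
    | succ t =>
      rw [restartProb, outcomeProb_stateAt hM]
      refine Finset.sum_nonneg fun x hx => mul_nonneg (ih _ ?_) (M.roundProb_nonneg _ _ _)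
      have := Finset.HasAntidiagonal.mem_antidiagonal.1 hx
      omega

lemma ofReal_sum_restartProb_mul {g : ℕ → ℝ} (hg : ∀ t, 0 ≤ g t) (t : ℕ) :
    ENNReal.ofReal (∑ x ∈ Finset.HasAntidiagonal.antidiagonal t,
      M.restartProb w x.1 * g x.2) =
      ∑ x ∈ Finset.HasAntidiagonal.antidiagonal t,
        ENNReal.ofReal (M.restartProb w x.1) * ENNReal.ofReal (g x.2) := by
  rw [ENNReal.ofReal_sum_of_nonneg fun x _ =>
    mul_nonneg (restartProb_nonneg hM w _) (hg _)]
  exact Finset.sum_congr rfl fun x _ => ENNReal.ofReal_mul (restartProb_nonneg hM w _)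

/-- Halting times are a start time plus a time within the round, so the convolution factors:
expected number of rounds times the probability of `r` in one round. -/
lemma tsum_outcomeProb (r : StateRole Q) :
    ∑' t, ENNReal.ofReal (M.outcomeProb (M.evolve w (M.stateAt w t)) r) =
      (∑' t, ENNReal.ofReal (M.restartProb w t)) * ∑' t, ENNReal.ofReal (M.roundProb w r t) := by
  simp only [outcomeProb_stateAt hM, ofReal_sum_restartProb_mul hM w (M.roundProb_nonneg w r)]
  exact tsum_antidiagonal_mul (fun t => ENNReal.ofReal (M.restartProb w t))
    fun t => ENNReal.ofReal (M.roundProb w r t)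

/-- A form of Wald's identity: expected number of rounds times expected length of a round. -/
lemma expectedTime_eq :
    M.expectedTime w = (∑' t, ENNReal.ofReal (M.restartProb w t)) *
      ∑' t, ENNReal.ofReal (sqNorm (M.roundAt w M.start t)) := by
  simp only [expectedTime, trace_stateAt hM, ofReal_sum_restartProb_mul hM w
    (g := fun t => sqNorm (M.roundAt w M.start t)) (fun t => sqNorm_nonneg _)]
  exact tsum_antidiagonal_mul (fun t => ENNReal.ofReal (M.restartProb w t))
    fun t => ENNReal.ofReal (sqNorm (M.roundAt w M.start t))

lemma tsum_restartProb (hc : ∑' t, ENNReal.ofReal (M.roundProb w (.reset M.start) t) < 1) :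
    ∑' t, ENNReal.ofReal (M.restartProb w t) =
      (1 - ∑' t, ENNReal.ofReal (M.roundProb w (.reset M.start) t))⁻¹ := by
  refine tsum_renewal (by simp [restartProb]) (fun t => ?_) (fun t => ENNReal.ofReal_ne_top) hc
  rw [restartProb, outcomeProb_stateAt hM,
    ofReal_sum_restartProb_mul hM w (M.roundProb_nonneg w _)]

end IsRestart

/-- Started from the superposition `v`, a round has ended after `k` steps, and it has been ended by
acceptance, rejection and restart with the probabilities `a`, `b` and `c`. -/
structure EndsRound (M : TwoWayQFAReset Q A) (w : List A) (k : ℕ) (v : QConfig Q w → ℂ)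
    (a b c : ℝ) : Prop where
  zero : (M.roundStep w)^[k] v = 0
  acc : ∑ t ∈ Finset.range k,
    M.pureProb ((evolutionMatrix M.δ w).mulVec ((M.roundStep w)^[t] v)) .acc = a
  rej : ∑ t ∈ Finset.range k,
    M.pureProb ((evolutionMatrix M.δ w).mulVec ((M.roundStep w)^[t] v)) .rej = b
  reset : ∑ t ∈ Finset.range k,
    M.pureProb ((evolutionMatrix M.δ w).mulVec ((M.roundStep w)^[t] v)) (.reset M.start) = c

lemma EndsRound.nil (M : TwoWayQFAReset Q A) (w : List A) : M.EndsRound w 0 0 0 0 0 :=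
  ⟨rfl, rfl, rfl, rfl⟩

/-- Rounds are analysed backwards from their end, prepending one step at a time. -/
lemma EndsRound.step {M : TwoWayQFAReset Q A} {w : List A} {k : ℕ} {v u : QConfig Q w → ℂ}
    {a b c a' b' c' : ℝ} (h : M.EndsRound w k (M.roundStep w v) a b c)
    (hu : (evolutionMatrix M.δ w).mulVec v = u)
    (ha : a' = a + M.pureProb u .acc) (hb : b' = b + M.pureProb u .rej)
    (hc : c' = c + M.pureProb u (.reset M.start)) : M.EndsRound w (k + 1) v a' b' c' := by
  subst hu ha hb hc
  refine ⟨h.zero, ?_, ?_, ?_⟩ <;> rw [Finset.sum_range_succ']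
  · exact congrArg₂ (· + ·) h.acc rfl
  · exact congrArg₂ (· + ·) h.rej rfl
  · exact congrArg₂ (· + ·) h.reset rfl

lemma roundStep_zero (M : TwoWayQFAReset Q A) (w : List A) : M.roundStep w 0 = 0 := by
  ext c
  simp [roundStep]

section total

variable {M : TwoWayQFAReset Q A} {w : List A} {k : ℕ} {a b c : ℝ}
  (h : M.EndsRound w k (Pi.single (M.start, 0) 1) a b c)

include h

lemma EndsRound.roundAt_eq_zero {t : ℕ} (ht : k ≤ t) : M.roundAt w M.start t = 0 := by
  obtain ⟨s, rfl⟩ := Nat.exists_eq_add_of_le ht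
  rw [roundAt_eq_iterate, add_comm, Function.iterate_add_apply, h.zero]
  exact Function.iterate_fixed (M.roundStep_zero w) s

lemma EndsRound.tsum_roundProb (r : StateRole Q) :
    ∑' t, ENNReal.ofReal (M.roundProb w r t) =
      ENNReal.ofReal (∑ t ∈ Finset.range k, M.roundProb w r t) := by
  rw [ENNReal.ofReal_sum_of_nonneg fun t _ => M.roundProb_nonneg w r t]
  refine tsum_eq_sum fun t ht => ?_
  rw [roundProb, h.roundAt_eq_zero (by simpa using ht)]
  simp [pureProb]

lemma EndsRound.tsum_acc : ∑' t, ENNReal.ofReal (M.roundProb w .acc t) = ENNReal.ofReal a := by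
  rw [h.tsum_roundProb, ← h.acc]
  simp only [roundProb, roundAt_eq_iterate]

lemma EndsRound.tsum_rej : ∑' t, ENNReal.ofReal (M.roundProb w .rej t) = ENNReal.ofReal b := by
  rw [h.tsum_roundProb, ← h.rej]
  simp only [roundProb, roundAt_eq_iterate]

lemma EndsRound.tsum_reset :
    ∑' t, ENNReal.ofReal (M.roundProb w (.reset M.start) t) = ENNReal.ofReal c := by
  rw [h.tsum_roundProb, ← h.reset]
  simp only [roundProb, roundAt_eq_iterate]

lemma EndsRound.reset_nonneg : 0 ≤ c := by
  rw [← h.reset]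
  exact Finset.sum_nonneg fun t _ => M.pureProb_nonneg _ _

lemma EndsRound.tsum_restartProb (hM : M.IsRestart) (hc : c < 1) :
    ∑' t, ENNReal.ofReal (M.restartProb w t) = ENNReal.ofReal (1 - c)⁻¹ := by
  rw [TwoWayQFAReset.tsum_restartProb hM w (by rw [h.tsum_reset]; exact ENNReal.ofReal_lt_one.2 hc),
    h.tsum_reset, ENNReal.ofReal_inv_of_pos (sub_pos.2 hc), ENNReal.ofReal_sub _ h.reset_nonneg,
    ENNReal.ofReal_one]

lemma EndsRound.acceptProb_eq (hM : M.IsRestart) (hc : c < 1) :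
    M.acceptProb w = ENNReal.ofReal (a / (1 - c)) := by
  rw [acceptProb, tsum_outcomeProb hM, h.tsum_restartProb hM hc, h.tsum_acc,
    ← ENNReal.ofReal_mul (inv_nonneg.2 (sub_nonneg.2 hc.le)), inv_mul_eq_div]

lemma EndsRound.rejectProb_eq (hM : M.IsRestart) (hc : c < 1) :
    M.rejectProb w = ENNReal.ofReal (b / (1 - c)) := by
  rw [rejectProb, tsum_outcomeProb hM, h.tsum_restartProb hM hc, h.tsum_rej,
    ← ENNReal.ofReal_mul (inv_nonneg.2 (sub_nonneg.2 hc.le)), inv_mul_eq_div]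

lemma EndsRound.expectedTime_le (hM : M.IsRestart) (hc : c < 1) :
    M.expectedTime w ≤ ENNReal.ofReal (k / (1 - c)) := by
  rw [expectedTime_eq hM, h.tsum_restartProb hM hc, div_eq_inv_mul,
    ENNReal.ofReal_mul (inv_nonneg.2 (sub_nonneg.2 hc.le))]
  gcongr
  rw [tsum_eq_sum (s := Finset.range k), ENNReal.ofReal_natCast]
  · refine (Finset.sum_le_card_nsmul _ _ 1 fun t _ => ?_).trans_eq (by simp)
    exact ENNReal.ofReal_le_one.2 (M.sqNorm_roundAt_le_one w _ t)
  · intro t ht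
    rw [h.roundAt_eq_zero (by simpa using ht)]
    simp [sqNorm]

end total

end TwoWayQFAReset

/-! ### Deterministic stretches of a round -/

namespace TwoWayQFAReset

variable {Q A : Type*} [Fintype Q] [DecidableEq Q]

lemma roundStep_eq_of_mulVec_eq {M : TwoWayQFAReset Q A} {w : List A} {u v x : QConfig Q w → ℂ}
    (h : (evolutionMatrix M.δ w).mulVec v = x + u) (hx : ∀ c, M.role c.1 = .non → x c = 0)
    (hu : ∀ c, M.role c.1 ≠ .non → u c = 0) : M.roundStep w v = u := by
  ext c
  rw [roundStep, h]
  split_ifs with hc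
  · simp [hx c hc]
  · exact (hu c hc).symm

lemma pureProb_eq_zero_of_nonhalting {M : TwoWayQFAReset Q A} {w : List A} {u : QConfig Q w → ℂ}
    (hu : ∀ c, M.role c.1 ≠ .non → u c = 0) {r : StateRole Q} (hr : r ≠ .non) :
    M.pureProb u r = 0 := by
  refine Finset.sum_eq_zero fun c _ => ?_
  split_ifs with hc
  · simp [hu c (hc ▸ hr)]
  · rfl

lemma EndsRound.step_nonhalting {M : TwoWayQFAReset Q A} {w : List A} {k : ℕ}
    {v u : QConfig Q w → ℂ} {a b c : ℝ} (h : M.EndsRound w k u a b c)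
    (hvu : (evolutionMatrix M.δ w).mulVec v = u) (hu : ∀ c, M.role c.1 ≠ .non → u c = 0) :
    M.EndsRound w (k + 1) v a b c := by
  have hstep : M.roundStep w v = u :=
    roundStep_eq_of_mulVec_eq (x := 0) (by rw [hvu, zero_add]) (fun _ _ => rfl) hu
  refine EndsRound.step (hstep ▸ h) hvu ?_ ?_ ?_ <;>
    rw [pureProb_eq_zero_of_nonhalting hu (by simp), add_zero]

/-- The configuration `c` evolves deterministically, through nonhalting configurations, into `d`
in `n` steps. -/
inductive Chain (M : TwoWayQFAReset Q A) (w : List A) : ℕ → QConfig Q w → QConfig Q w → Prop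
  | refl (c : QConfig Q w) : Chain M w 0 c c
  | step {n : ℕ} {c c' d : QConfig Q w} (hr : M.role c'.1 = .non)
      (h : ∀ z : ℂ, (evolutionMatrix M.δ w).mulVec (Pi.single c z) = Pi.single c' z)
      (hc : Chain M w n c' d) : Chain M w (n + 1) c d

section Chain

variable {M : TwoWayQFAReset Q A} {w : List A}

lemma Chain.trans {n m : ℕ} {c d e : QConfig Q w} (h : M.Chain w n c d) (h' : M.Chain w m d e) :
    M.Chain w (n + m) c e := by
  induction h with
  | refl c => rwa [zero_add]
  | step hr hs _ ih => rw [Nat.add_right_comm]; exact .step hr hs (ih h')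

/-- Serves to cut the slower path at the moment when the faster one arrives. -/
lemma Chain.split {n m : ℕ} {c e : QConfig Q w} (h : M.Chain w (n + m) c e) :
    ∃ d, M.Chain w n c d ∧ M.Chain w m d e := by
  induction n generalizing c with
  | zero => exact ⟨c, .refl c, by rwa [zero_add] at h⟩
  | succ n ih =>
    rw [Nat.add_right_comm] at h
    cases h with
    | step hr hs h =>
      obtain ⟨d, h1, h2⟩ := ih h
      exact ⟨d, .step hr hs h1, h2⟩

lemma single_eq_zero_of_nonhalting {c : QConfig Q w} (hc : M.role c.1 = .non) (z : ℂ) :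
    ∀ d : QConfig Q w, M.role d.1 ≠ .non → (Pi.single c z : QConfig Q w → ℂ) d = 0 := by
  intro d hd
  rw [Pi.single_eq_of_ne]
  rintro rfl
  exact hd hc

/-- By linearity two paths run in parallel without interacting. The common length `n` matters: it
synchronizes them at `d` and `d'`. -/
lemma Chain.endsRound_add {n k : ℕ} {c c' d d' : QConfig Q w} {z z' : ℂ} {a b r : ℝ}
    (h : M.Chain w n c d) (h' : M.Chain w n c' d')
    (hd : M.EndsRound w k (Pi.single d z + Pi.single d' z') a b r) :
    M.EndsRound w (k + n) (Pi.single c z + Pi.single c' z') a b r := by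
  induction h generalizing c' with
  | refl c =>
    cases h'
    exact hd
  | step hr hs _ ih =>
    cases h' with
    | step hr' hs' h' =>
      refine (ih h' hd).step_nonhalting (by rw [Matrix.mulVec_add, hs, hs']) fun c hc => ?_
      rw [Pi.add_apply, single_eq_zero_of_nonhalting hr z c hc,
        single_eq_zero_of_nonhalting hr' z' c hc, add_zero]

lemma Chain.endsRound {n k : ℕ} {c d : QConfig Q w} {z : ℂ} {a b r : ℝ} (h : M.Chain w n c d)
    (hd : M.EndsRound w k (Pi.single d z) a b r) :
    M.EndsRound w (k + n) (Pi.single c z) a b r := by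
  have := h.endsRound_add h (z := z) (z' := 0) (by simpa using hd)
  simpa using this

end Chain

end TwoWayQFAReset

/-! ### Tape contents and head positions -/

lemma tapeOf_zero {A : Type*} (w : List A) : tapeOf w 0 = .leftEnd := rfl

lemma tapeOf_succ {A : Type*} (w : List A) {k : ℕ} (hk : k < w.length) :
    tapeOf w ⟨k + 1, by omega⟩ = .letter w[k] := by
  simp [tapeOf, List.getElem_append_left, hk]

lemma tapeOf_last {A : Type*} (w : List A) :
    tapeOf w ⟨w.length + 1, by omega⟩ = .rightEnd := by
  simp [tapeOf]

lemma HeadMove.right_apply {n k : ℕ} (hk : k + 1 < n + 2) :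
    HeadMove.right.apply (⟨k, by omega⟩ : Fin (n + 2)) = ⟨k + 1, hk⟩ := by
  apply Fin.ext
  simp [HeadMove.apply, Fin.val_add, Nat.mod_eq_of_lt hk]

lemma HeadMove.left_apply {n k : ℕ} (hk : k + 1 < n + 2) :
    HeadMove.left.apply (⟨k + 1, hk⟩ : Fin (n + 2)) = ⟨k, by omega⟩ := by
  rw [← HeadMove.right_apply hk]
  simp [HeadMove.apply]

/-! ### The ten-state automaton -/

namespace LeqAutomaton

open TwoWayQFAReset

/-- scanning the leading `a`s to the right -/
abbrev scanA : Fin 10 := 0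
/-- stepping back from the first symbol after the leading `a`s -/
abbrev back : Fin 10 := 1
/-- scanning the `b`s to the right -/
abbrev scanB : Fin 10 := 2
/-- moving to the left on the path that waits on every `a` -/
abbrev goA : Fin 10 := 3
/-- waiting on an `a` -/
abbrev waitA : Fin 10 := 4
/-- moving to the left on the path that waits on every `b` -/
abbrev goB : Fin 10 := 5
/-- waiting on a `b` -/
abbrev waitB : Fin 10 := 6
/-- the accepting state -/
abbrev yes : Fin 10 := 7
/-- the rejecting state -/
abbrev no : Fin 10 := 8
/-- the restart state -/
abbrev again : Fin 10 := 9

/-- the head movement made on entering a state -/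
def heading : Fin 10 → HeadMove :=
  ![.right, .left, .right, .left, .stay, .left, .stay, .stay, .stay, .stay]

/-- the roles of the states -/
def stateRole : Fin 10 → StateRole (Fin 10) :=
  ![.non, .non, .non, .non, .non, .non, .non, .acc, .rej, .reset scanA]

/-- the amplitude `1 / √2` -/
noncomputable abbrev half : ℝ := √(1 / 2)

/-- the action of the symbols on the states, where `e` is the probability of accepting, rather than
restarting, after the two paths have met -/
noncomputable def symbolOperator (e : ℝ) : TapeSymbol LetterAB → Matrix (Fin 10) (Fin 10) ℂ
  | .leftEnd => planeReflection yes again (√e) (√(1 - e)) *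
      (permutationOperator (Equiv.swap back scanB * Equiv.swap goA yes * Equiv.swap goB no) *
        planeReflection goA goB half half)
  | .letter .a =>
      permutationOperator (Equiv.swap back scanB * Equiv.swap scanB no * Equiv.swap goA waitA)
  | .letter .b => permutationOperator (Equiv.swap scanA back * Equiv.swap goB waitB)
  | .rightEnd => planeReflection goA goB half half *
      permutationOperator (Equiv.swap scanA back * Equiv.swap scanB goA)

lemma half_sq : half ^ 2 + half ^ 2 = 1 := by
  rw [Real.sq_sqrt (by norm_num)]; norm_num

lemma symbolOperator_unitary {e : ℝ} (he : 0 ≤ e) (he' : e ≤ 1) (σ : TapeSymbol LetterAB) :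
    symbolOperator e σ ∈ Matrix.unitaryGroup (Fin 10) ℂ := by
  have h1 : planeReflection goA goB half half ∈ Matrix.unitaryGroup (Fin 10) ℂ :=
    planeReflection_unitary (by decide) _ _ half_sq
  have h2 : planeReflection yes again (√e) (√(1 - e)) ∈ Matrix.unitaryGroup (Fin 10) ℂ := by
    refine planeReflection_unitary (by decide) _ _ ?_
    rw [Real.sq_sqrt he, Real.sq_sqrt (by linarith)]
    ring
  rcases σ with _ | (_ | _) | _
  · exact mul_mem h2 (mul_mem (permutationOperator_unitary _) h1)
  · exact permutationOperator_unitary _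
  · exact permutationOperator_unitary _
  · exact mul_mem h1 (permutationOperator_unitary _)

/-- The automaton for `Leq`. It checks that the input is of the form `aⁱbʲ`, then sends two paths
back to the left end-marker, one waiting on every `a` and the other on every `b`, and lets them
interfere there. -/
noncomputable def automaton (e : ℝ) (he : 0 ≤ e) (he' : e ≤ 1) :
    TwoWayQFAReset (Fin 10) LetterAB where
  δ := headedTransition heading (symbolOperator e)
  start := scanA
  role := stateRole
  start_non := rfl
  target_non := by decide
  unitary := headedTransition_unitary _ _ (symbolOperator_unitary he he')

variable {e : ℝ} (he : 0 ≤ e) (he' : e ≤ 1)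

lemma automaton_isRestart : (automaton e he he').IsRestart := by
  change ∀ p q : Fin 10, stateRole p = .reset q → q = scanA
  decide

lemma automaton_mulVec_single {w : List LetterAB} (q : Fin 10) (i : Fin (w.length + 2)) (z : ℂ) :
    (evolutionMatrix (automaton e he he').δ w).mulVec (Pi.single (q, i) z) =
      spread heading i ((symbolOperator e (tapeOf w i)).mulVec (Pi.single q z)) :=
  evolutionMatrix_headedTransition_mulVec_single _ _ _ _ _ _

lemma chain_one {w : List LetterAB} {q q' : Fin 10} {i j : Fin (w.length + 2)}
    (hr : stateRole q' = .non)
    (h : ∀ z, (symbolOperator e (tapeOf w i)).mulVec (Pi.single q z) = Pi.single q' z)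
    (hj : (heading q').apply i = j) : (automaton e he he').Chain w 1 (q, i) (q', j) := by
  refine Chain.step (c' := (q', j)) (show (automaton e he he').role q' = .non from hr)
    (fun z => ?_) (.refl _)
  rw [automaton_mulVec_single, h, spread_single, hj]

lemma symbolOperator_a (q : Fin 10) (z : ℂ) :
    (symbolOperator e (.letter .a)).mulVec (Pi.single q z) = Pi.single
      ((Equiv.swap back scanB * Equiv.swap scanB no * Equiv.swap goA waitA : Equiv.Perm _) q) z :=
  permutationOperator_mulVec _ _ _

lemma symbolOperator_b (q : Fin 10) (z : ℂ) :
    (symbolOperator e (.letter .b)).mulVec (Pi.single q z) = Pi.single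
      ((Equiv.swap scanA back * Equiv.swap goB waitB : Equiv.Perm _) q) z :=
  permutationOperator_mulVec _ _ _

lemma symbolOperator_leftEnd_of_ne {q : Fin 10} (h1 : q ≠ goA) (h2 : q ≠ goB) {q' : Fin 10}
    (hq' : (Equiv.swap back scanB * Equiv.swap goA yes * Equiv.swap goB no : Equiv.Perm _) q = q')
    (h3 : q' ≠ yes) (h4 : q' ≠ again) (z : ℂ) :
    (symbolOperator e .leftEnd).mulVec (Pi.single q z) = Pi.single q' z := by
  rw [symbolOperator, ← Matrix.mulVec_mulVec, ← Matrix.mulVec_mulVec,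
    planeReflection_mulVec_of_ne _ _ h1 h2, permutationOperator_mulVec, hq',
    planeReflection_mulVec_of_ne _ _ h3 h4]

lemma symbolOperator_leftEnd_goA (z : ℂ) :
    (symbolOperator e .leftEnd).mulVec (Pi.single goA z) =
      Pi.single yes (√e * (half * z)) + Pi.single again (√(1 - e) * (half * z)) +
        Pi.single no (half * z) := by
  rw [symbolOperator, ← Matrix.mulVec_mulVec, ← Matrix.mulVec_mulVec,
    planeReflection_mulVec_left (by decide), Matrix.mulVec_add, permutationOperator_mulVec,
    permutationOperator_mulVec, Matrix.mulVec_add]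
  rw [show (Equiv.swap back scanB * Equiv.swap goA yes * Equiv.swap goB no : Equiv.Perm _) goA =
    yes by decide, show (Equiv.swap back scanB * Equiv.swap goA yes * Equiv.swap goB no :
    Equiv.Perm _) goB = no by decide, planeReflection_mulVec_left (by decide),
    planeReflection_mulVec_of_ne _ _ (by decide) (by decide)]

/-- Differs from the image of `goA` only in the sign at `no`, which is the source of the
cancellation. -/
lemma symbolOperator_leftEnd_goB (z : ℂ) :
    (symbolOperator e .leftEnd).mulVec (Pi.single goB z) =
      Pi.single yes (√e * (half * z)) + Pi.single again (√(1 - e) * (half * z)) +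
        Pi.single no (-half * z) := by
  rw [symbolOperator, ← Matrix.mulVec_mulVec, ← Matrix.mulVec_mulVec,
    planeReflection_mulVec_right (by decide), Matrix.mulVec_add, permutationOperator_mulVec,
    permutationOperator_mulVec, Matrix.mulVec_add]
  rw [show (Equiv.swap back scanB * Equiv.swap goA yes * Equiv.swap goB no : Equiv.Perm _) goA =
    yes by decide, show (Equiv.swap back scanB * Equiv.swap goA yes * Equiv.swap goB no :
    Equiv.Perm _) goB = no by decide, planeReflection_mulVec_left (by decide),
    planeReflection_mulVec_of_ne _ _ (by decide) (by decide)]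

lemma symbolOperator_rightEnd_scanA (z : ℂ) :
    (symbolOperator e .rightEnd).mulVec (Pi.single scanA z) = Pi.single back z := by
  rw [symbolOperator, ← Matrix.mulVec_mulVec, permutationOperator_mulVec]
  exact planeReflection_mulVec_of_ne _ _ (by decide) (by decide) z

lemma symbolOperator_rightEnd_scanB (z : ℂ) :
    (symbolOperator e .rightEnd).mulVec (Pi.single scanB z) =
      Pi.single goA (half * z) + Pi.single goB (half * z) := by
  rw [symbolOperator, ← Matrix.mulVec_mulVec, permutationOperator_mulVec]
  exact planeReflection_mulVec_left (by decide) _ _ z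

/-! ### The deterministic parts of a round -/

lemma chain_scanA {w : List LetterAB} {i : ℕ} (hi : i ≤ w.length)
    (h : ∀ k (hk : k < w.length), k < i → w[k] = .a) :
    (automaton e he he').Chain w (i + 1) (scanA, 0) (scanA, ⟨i + 1, by omega⟩) := by
  induction i with
  | zero =>
    refine chain_one he he' rfl (fun z => ?_) (HeadMove.right_apply (k := 0) (by omega))
    exact symbolOperator_leftEnd_of_ne (by decide) (by decide) (by decide) (by decide)
      (by decide) z
  | succ i ih =>
    refine (ih (by omega) fun k hk hki => h k hk (by omega)).trans
      (chain_one he he' rfl (fun z => ?_) (HeadMove.right_apply (by omega)))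
    rw [tapeOf_succ w (by omega), h i (by omega) (by omega), symbolOperator_a]
    rfl

/-- On `b` the state `scanB` is already its own image, so `scanA` cannot also be sent there by a
permutation. The detour through `back` makes the change of state on the preceding square instead. -/
lemma chain_turn {w : List LetterAB} {i : ℕ} (hi : i ≤ w.length)
    (h : ∀ k (hk : k < w.length), k < i → w[k] = .a)
    (h' : ∀ hi : i < w.length, w[i] = .b) :
    (automaton e he he').Chain w 2 (scanA, ⟨i + 1, by omega⟩) (scanB, ⟨i + 1, by omega⟩) := by
  have h1 : (automaton e he he').Chain w 1 (scanA, ⟨i + 1, by omega⟩) (back, ⟨i, by omega⟩) := by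
    refine chain_one he he' rfl (fun z => ?_) (HeadMove.left_apply (by omega))
    rcases hi.lt_or_eq with hi | rfl
    · rw [tapeOf_succ w hi, h' hi, symbolOperator_b]
      rfl
    · rw [tapeOf_last, symbolOperator_rightEnd_scanA]
  refine h1.trans (chain_one he he' (q' := scanB) rfl (fun z => ?_)
    (HeadMove.right_apply (k := i) (by omega)))
  -- For `i = 0` the preceding square is the left end-marker; otherwise it holds an `a`.
  cases i with
  | zero =>
    exact symbolOperator_leftEnd_of_ne (by decide) (by decide) (by decide) (by decide)
      (by decide) z
  | succ i =>
    rw [tapeOf_succ w (by omega), h i (by omega) (by omega), symbolOperator_a]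
    rfl

lemma chain_scanB {w : List LetterAB} {i j : ℕ} (hij : i + j ≤ w.length)
    (h : ∀ k (hk : k < w.length), i ≤ k → k < i + j → w[k] = .b) :
    (automaton e he he').Chain w j (scanB, ⟨i + 1, by omega⟩) (scanB, ⟨i + j + 1, by omega⟩) := by
  induction j with
  | zero => exact .refl _
  | succ j ih =>
    refine (ih (by omega) fun k hk h1 h2 => h k hk h1 (by omega)).trans
      (chain_one he he' rfl (fun z => ?_) (HeadMove.right_apply (by omega)))
    rw [tapeOf_succ w (by omega), h (i + j) (by omega) (by omega) (by omega), symbolOperator_b]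
    rfl

lemma chain_check {w : List LetterAB} {i j : ℕ} (hij : i + j ≤ w.length)
    (ha : ∀ k (hk : k < w.length), k < i → w[k] = .a)
    (hb : ∀ k (hk : k < w.length), i ≤ k → k < i + j → w[k] = .b)
    (hi : j = 0 → i = w.length) :
    (automaton e he he').Chain w (i + 1 + 2 + j) (scanA, 0) (scanB, ⟨i + j + 1, by omega⟩) := by
  refine ((chain_scanA he he' (by omega) ha).trans (chain_turn he he' (by omega) ha ?_)).trans
    (chain_scanB he he' hij hb)
  -- When `i < w.length`, `hi` rules out `j = 0`, so the letter at `i` lies in the block of `b`s.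
  exact fun h => hb i h le_rfl (by omega)

/-- Each square costs one step to the left, and each `a` one more for the stay in `waitA`. -/
lemma chain_goA {w : List LetterAB} {k : ℕ} (hk : k ≤ w.length) :
    (automaton e he he').Chain w (k + (w.take k).count .a) (goA, ⟨k, by omega⟩) (goA, 0) := by
  induction k with
  | zero => exact .refl _
  | succ k ih =>
    rw [List.take_add_one, List.getElem?_eq_getElem (by omega), Option.toList_some,
      List.count_append]
    have hmove : (automaton e he he').Chain w (1 + [w[k]].count .a) (goA, ⟨k + 1, by omega⟩)
        (goA, ⟨k, by omega⟩) := by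
      rcases hw : w[k] with _ | _
      · refine Chain.trans (d := (waitA, ⟨k + 1, by omega⟩))
          (chain_one he he' rfl (fun z => ?_) rfl)
          (chain_one he he' rfl (fun z => ?_) (HeadMove.left_apply (by omega)))
        all_goals
          rw [tapeOf_succ w (by omega), hw, symbolOperator_a]
          rfl
      · refine chain_one he he' rfl (fun z => ?_) (HeadMove.left_apply (by omega))
        rw [tapeOf_succ w (by omega), hw, symbolOperator_b]
        rfl
    have := hmove.trans (ih (by omega))
    convert this using 1
    omega

lemma chain_goB {w : List LetterAB} {k : ℕ} (hk : k ≤ w.length) :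
    (automaton e he he').Chain w (k + (w.take k).count .b) (goB, ⟨k, by omega⟩) (goB, 0) := by
  induction k with
  | zero => exact .refl _
  | succ k ih =>
    rw [List.take_add_one, List.getElem?_eq_getElem (by omega), Option.toList_some,
      List.count_append]
    have hmove : (automaton e he he').Chain w (1 + [w[k]].count .b) (goB, ⟨k + 1, by omega⟩)
        (goB, ⟨k, by omega⟩) := by
      rcases hw : w[k] with _ | _
      · refine chain_one he he' rfl (fun z => ?_) (HeadMove.left_apply (by omega))
        rw [tapeOf_succ w (by omega), hw, symbolOperator_a]
        rfl
      · refine Chain.trans (d := (waitB, ⟨k + 1, by omega⟩))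
          (chain_one he he' rfl (fun z => ?_) rfl)
          (chain_one he he' rfl (fun z => ?_) (HeadMove.left_apply (by omega)))
        all_goals
          rw [tapeOf_succ w (by omega), hw, symbolOperator_b]
          rfl
    have := hmove.trans (ih (by omega))
    convert this using 1
    omega

/-! ### The ends of a round -/

/-- The superposition of halting and restart configurations with the given amplitudes. -/
def haltingState {n : ℕ} (i : Fin (n + 2)) (α β γ : ℂ) : Fin 10 × Fin (n + 2) → ℂ :=
  Pi.single (yes, i) α + Pi.single (no, i) β + Pi.single (again, i) γ

lemma haltingState_apply {n : ℕ} (i : Fin (n + 2)) (α β γ : ℂ) (c : Fin 10 × Fin (n + 2)) :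
    haltingState i α β γ c =
      if c = (yes, i) then α else if c = (no, i) then β else if c = (again, i) then γ else 0 := by
  have h1 : yes ≠ no := by decide
  have h2 : yes ≠ again := by decide
  have h3 : no ≠ again := by decide
  obtain ⟨q, j⟩ := c
  by_cases hy : q = yes
  · subst hy
    by_cases hj : j = i <;> simp [haltingState, hj, h1, h2]
  · by_cases hn : q = no
    · subst hn
      by_cases hj : j = i <;> simp [haltingState, hj, h1.symm, h3]
    · simp [haltingState, Pi.single_apply, hy, hn]

lemma endsRound_step_halting {w : List LetterAB} {k : ℕ} {v u : QConfig (Fin 10) w → ℂ}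
    {a b c a' b' c' : ℝ} (i : Fin (w.length + 2)) {α β γ : ℂ}
    (h : (automaton e he he').EndsRound w k u a b c)
    (hv : (evolutionMatrix (automaton e he he').δ w).mulVec v = haltingState i α β γ + u)
    (hu : ∀ c, (automaton e he he').role c.1 ≠ .non → u c = 0)
    (ha : a' = a + Complex.normSq α) (hb : b' = b + Complex.normSq β)
    (hc : c' = c + Complex.normSq γ) :
    (automaton e he he').EndsRound w (k + 1) v a' b' c' := by
  have hrole : ∀ q : Fin 10, (automaton e he he').role q = stateRole q := fun _ => rfl
  -- Each halting or restart role belongs to a single state and only the square `i` is occupied, so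
  -- an outcome probability is one squared amplitude.
  have hprob : ∀ (q : Fin 10), stateRole q ≠ .non →
      (∀ q', stateRole q' = stateRole q → q' = q) →
      (automaton e he he').pureProb (haltingState i α β γ + u) (stateRole q) =
        Complex.normSq (if q = yes then α else if q = no then β else if q = again then γ else 0) := by
    intro q hq hq'
    have happly : haltingState i α β γ (q, i) =
        if q = yes then α else if q = no then β else if q = again then γ else 0 := by
      simp [haltingState_apply]
    rw [← happly]
    rw [pureProb, Finset.sum_eq_single (q, i)]
    · rw [if_pos (hrole q), Pi.add_apply, hu (q, i) hq, add_zero]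
    · rintro ⟨p, j⟩ _ hp
      split_ifs with hpq
      · obtain rfl := hq' p hpq
        have hj : j ≠ i := fun hj => hp (by rw [hj])
        rw [Pi.add_apply, hu (p, j) hq, haltingState_apply]
        simp [hj]
      · rfl
    · simp
  have hstep : (automaton e he he').roundStep w v = u := by
    refine roundStep_eq_of_mulVec_eq hv (fun c hc => ?_) hu
    rw [haltingState_apply, if_neg, if_neg, if_neg]
    all_goals
      rintro rfl
      exact absurd hc (by rw [hrole]; dsimp only; decide)
  refine EndsRound.step (hstep ▸ h) hv (ha.trans ?_) (hb.trans ?_) (hc.trans ?_)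
  · exact congrArg (a + ·) (hprob yes (by decide) (by decide)).symm
  · exact congrArg (b + ·) (hprob no (by decide) (by decide)).symm
  · exact congrArg (c + ·) (hprob again (by decide) (by decide)).symm

lemma mulVec_single_goA {w : List LetterAB} (z : ℂ) :
    (evolutionMatrix (automaton e he he').δ w).mulVec (Pi.single (goA, 0) z) =
      haltingState 0 (√e * (half * z)) (half * z) (√(1 - e) * (half * z)) := by
  rw [automaton_mulVec_single, tapeOf_zero, symbolOperator_leftEnd_goA, spread_add, spread_add,
    spread_single, spread_single, spread_single, add_right_comm]
  rfl

lemma mulVec_single_goB {w : List LetterAB} (z : ℂ) :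
    (evolutionMatrix (automaton e he he').δ w).mulVec (Pi.single (goB, 0) z) =
      haltingState 0 (√e * (half * z)) (-half * z) (√(1 - e) * (half * z)) := by
  rw [automaton_mulVec_single, tapeOf_zero, symbolOperator_leftEnd_goB, spread_add, spread_add,
    spread_single, spread_single, spread_single, add_right_comm]
  rfl

lemma haltingState_add {n : ℕ} (i : Fin (n + 2)) (α β γ α' β' γ' : ℂ) :
    haltingState i α β γ + haltingState i α' β' γ' =
      haltingState i (α + α') (β + β') (γ + γ') := by
  simp only [haltingState, Pi.single_add]
  abel

lemma normSq_half : Complex.normSq (half : ℂ) = 1 / 2 := by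
  rw [Complex.normSq_ofReal, Real.mul_self_sqrt (by norm_num)]

include he in
lemma normSq_sqrt : Complex.normSq (√e : ℂ) = e := by
  rw [Complex.normSq_ofReal, Real.mul_self_sqrt he]

include he' in
lemma normSq_sqrt_one_sub : Complex.normSq (√(1 - e) : ℂ) = 1 - e :=
  normSq_sqrt (by linarith)

/-- The two contributions `half * half` add up to `1` before the accept/restart reflection, and
cancel at `no`. -/
lemma endsRound_together {w : List LetterAB} {n : ℕ} {c c' : QConfig (Fin 10) w}
    (h : (automaton e he he').Chain w n c (goA, 0))
    (h' : (automaton e he he').Chain w n c' (goB, 0)) :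
    (automaton e he he').EndsRound w (1 + n) (Pi.single c half + Pi.single c' half)
      e 0 (1 - e) := by
  refine h.endsRound_add h' ?_
  have hhalf : (half * half + half * half : ℂ) = 1 := by
    have := half_sq
    rw [pow_two] at this
    exact_mod_cast this
  refine endsRound_step_halting he he' 0 (EndsRound.nil _ _) (α := √e) (β := 0) (γ := √(1 - e))
    ?_ (fun _ _ => rfl) ?_ ?_ ?_
  · have hx : ∀ x : ℂ, x * (half * half) + x * (half * half) = x := fun x => by
      rw [← mul_add, hhalf, mul_one]
    rw [Matrix.mulVec_add, mulVec_single_goA, mulVec_single_goB, haltingState_add, hx, hx,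
      neg_mul, add_neg_cancel, add_zero]
  · rw [normSq_sqrt he, zero_add]
  · simp
  · rw [normSq_sqrt_one_sub he', zero_add]

/-- The first arrival is measured while the other path is still nonhalting, so probabilities add
instead of amplitudes, and the sign at `no` has no effect. -/
lemma endsRound_goA_first {w : List LetterAB} {n m : ℕ} (hnm : n < m) {c c' : QConfig (Fin 10) w}
    (h : (automaton e he he').Chain w n c (goA, 0))
    (h' : (automaton e he he').Chain w m c' (goB, 0)) :
    (automaton e he he').EndsRound w (1 + m) (Pi.single c half + Pi.single c' half)
      (e / 2) (1 / 2) ((1 - e) / 2) := by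
  obtain ⟨l, rfl⟩ := Nat.exists_eq_add_of_lt hnm
  rw [add_assoc] at h'
  obtain ⟨d, h1, h2⟩ := h'.split
  have hlast : (automaton e he he').EndsRound w 1 (Pi.single (goB, 0) half)
      (e / 4) (1 / 4) ((1 - e) / 4) := by
    refine endsRound_step_halting he he' 0 (EndsRound.nil _ _)
      ((mulVec_single_goB he he' _).trans (add_zero _).symm) (fun _ _ => rfl) ?_ ?_ ?_
    all_goals
      simp only [Complex.normSq_mul, Complex.normSq_neg, normSq_half, normSq_sqrt he,
        normSq_sqrt_one_sub he']
      ring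
  rw [show 1 + (n + l + 1) = 1 + l + 1 + n by omega]
  refine h.endsRound_add h1 ?_
  -- The remaining chain has length `l + 1`, so the slower path makes another nonhalting step while
  -- the faster one halts.
  cases h2 with
  | step hr hs h2 =>
    refine endsRound_step_halting he he' 0 (h2.endsRound hlast)
      (by rw [Matrix.mulVec_add, mulVec_single_goA, hs])
      (single_eq_zero_of_nonhalting hr _) ?_ ?_ ?_
    all_goals
      simp only [Complex.normSq_mul, normSq_half, normSq_sqrt he, normSq_sqrt_one_sub he']
      ring

lemma endsRound_goB_first {w : List LetterAB} {n m : ℕ} (hnm : m < n) {c c' : QConfig (Fin 10) w}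
    (h : (automaton e he he').Chain w n c (goA, 0))
    (h' : (automaton e he he').Chain w m c' (goB, 0)) :
    (automaton e he he').EndsRound w (1 + n) (Pi.single c half + Pi.single c' half)
      (e / 2) (1 / 2) ((1 - e) / 2) := by
  obtain ⟨l, rfl⟩ := Nat.exists_eq_add_of_lt hnm
  rw [add_assoc] at h
  obtain ⟨d, h1, h2⟩ := h.split
  have hlast : (automaton e he he').EndsRound w 1 (Pi.single (goA, 0) half)
      (e / 4) (1 / 4) ((1 - e) / 4) := by
    refine endsRound_step_halting he he' 0 (EndsRound.nil _ _)
      ((mulVec_single_goA he he' _).trans (add_zero _).symm) (fun _ _ => rfl) ?_ ?_ ?_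
    all_goals
      simp only [Complex.normSq_mul, normSq_half, normSq_sqrt he, normSq_sqrt_one_sub he']
      ring
  rw [show 1 + (m + l + 1) = 1 + l + 1 + m by omega]
  refine h1.endsRound_add h' ?_
  cases h2 with
  | step hr hs h2 =>
    refine endsRound_step_halting he he' 0 (h2.endsRound hlast)
      (by rw [Matrix.mulVec_add, mulVec_single_goB, hs, add_comm])
      (single_eq_zero_of_nonhalting hr _) ?_ ?_ ?_
    all_goals
      simp only [Complex.normSq_mul, Complex.normSq_neg, normSq_half, normSq_sqrt he,
        normSq_sqrt_one_sub he']
      ring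

lemma endsRound_split {w : List LetterAB} {k : ℕ} {a b c : ℝ}
    (h : (automaton e he he').EndsRound w k
      (Pi.single (goA, ⟨w.length, by omega⟩) half + Pi.single (goB, ⟨w.length, by omega⟩) half)
      a b c) :
    (automaton e he he').EndsRound w (k + 1) (Pi.single (scanB, ⟨w.length + 1, by omega⟩) 1)
      a b c := by
  refine h.step_nonhalting ?_ fun c hc => ?_
  · rw [automaton_mulVec_single, tapeOf_last, symbolOperator_rightEnd_scanB, spread_add,
      spread_single, spread_single, mul_one]
    exact congrArg₂ (fun i j => (Pi.single (goA, i) (half : ℂ) + Pi.single (goB, j) (half : ℂ) :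
      QConfig (Fin 10) w → ℂ))
      (HeadMove.left_apply (k := w.length) (by omega))
      (HeadMove.left_apply (k := w.length) (by omega))
  · rw [Pi.add_apply, single_eq_zero_of_nonhalting rfl _ c hc,
      single_eq_zero_of_nonhalting rfl _ c hc, add_zero]

lemma endsRound_malformed {w : List LetterAB} {k : ℕ} (hk : k < w.length) (hw : w[k] = .a) :
    (automaton e he he').EndsRound w 1 (Pi.single (scanB, ⟨k + 1, by omega⟩) 1) 0 1 0 := by
  refine endsRound_step_halting he he' ⟨k + 1, by omega⟩ (EndsRound.nil _ _)
    (α := 0) (β := 1) (γ := 0) ?_ (fun _ _ => rfl) (by simp) (by simp) (by simp)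
  rw [automaton_mulVec_single, tapeOf_succ w hk, hw, symbolOperator_a, spread_single]
  simp only [haltingState, Pi.single_zero, zero_add, add_zero]
  rfl

/-! ### Outcome of a round according to the shape of the word -/

lemma exists_replicate_append (w : List LetterAB) :
    ∃ i j, w = List.replicate i .a ++ List.replicate j .b ∨
      ∃ r, w = List.replicate i .a ++ (List.replicate (j + 1) .b ++ .a :: r) := by
  induction w with
  | nil => exact ⟨0, 0, .inl rfl⟩
  | cons x w ih =>
    obtain ⟨i, j, h⟩ := ih
    cases x with
    | a =>
      refine ⟨i + 1, j, ?_⟩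
      rcases h with rfl | ⟨r, rfl⟩
      · exact .inl rfl
      · exact .inr ⟨r, rfl⟩
    | b =>
      cases i with
      | zero =>
        refine ⟨0, j + 1, ?_⟩
        rcases h with rfl | ⟨r, rfl⟩
        · exact .inl rfl
        · exact .inr ⟨r, rfl⟩
      | succ i =>
        refine ⟨0, 0, .inr ?_⟩
        rcases h with rfl | ⟨r, rfl⟩
        · exact ⟨_, rfl⟩
        · exact ⟨_, rfl⟩

lemma endsRound_malformed_word (i j : ℕ) (r : List LetterAB) {w : List LetterAB}
    (hw : w = List.replicate i LetterAB.a ++ (List.replicate (j + 1) .b ++ .a :: r)) :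
    ∃ k ≤ 5 * (w.length + 1),
      (automaton e he he').EndsRound w k (Pi.single (scanA, 0) 1) 0 1 0 := by
  have hlen : w.length = i + (j + 1 + (r.length + 1)) := by simp [hw]
  refine ⟨_, ?_, (chain_check he he' (i := i) (j := j + 1) (by omega) ?_ ?_ (by simp)).endsRound
    (endsRound_malformed he he' (by omega) ?_)⟩
  · omega
  · intro k hk hki
    simp [hw, List.getElem_append_left, hki]
  · intro k hk h1 h2
    have h3 : k - i < j + 1 := by omega
    simp [hw, List.getElem_append_right, List.getElem_append_left, h1, h3]
  · simp [hw, List.getElem_append_right]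

lemma endsRound_of_count {w : List LetterAB} {i j : ℕ}
    (hw : w = List.replicate i LetterAB.a ++ List.replicate j LetterAB.b) {k : ℕ} {a b c : ℝ}
    (hk : k ≤ 1 + (w.length + w.length))
    (h : (automaton e he he').Chain w (w.length + i) (goA, ⟨w.length, by omega⟩) (goA, 0) →
      (automaton e he he').Chain w (w.length + j) (goB, ⟨w.length, by omega⟩) (goB, 0) →
      (automaton e he he').EndsRound w k
        (Pi.single (goA, ⟨w.length, by omega⟩) half + Pi.single (goB, ⟨w.length, by omega⟩) half)
        a b c) :
    ∃ k ≤ 5 * (w.length + 1),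
      (automaton e he he').EndsRound w k (Pi.single (scanA, 0) 1) a b c := by
  have hlen : w.length = i + j := by simp [hw]
  have hca : w.count .a = i := by simp [hw, List.count_replicate]
  have hcb : w.count .b = j := by simp [hw, List.count_replicate]
  have hA := chain_goA he he' (w := w) le_rfl
  have hB := chain_goB he he' (w := w) le_rfl
  rw [List.take_length, hca] at hA
  rw [List.take_length, hcb] at hB
  have hC := chain_check he he' (w := w) (i := i) (j := j) (by omega) ?_ ?_ (by omega)
  · refine ⟨_, ?_, hC.endsRound (k := k + 1) ?_⟩
    -- The check takes `|w| + 3` steps, the split `1` and the return at most `2|w| + 1`, in total at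
    -- most `3|w| + 5`.
    · omega
    · have := endsRound_split he he' (h hA hB)
      convert this using 5
      omega
  · intro k hk hki
    simp [hw, List.getElem_append_left, hki]
  · intro k hk h1 h2
    simp [hw, List.getElem_append_right, h1]

lemma endsRound_of_mem {w : List LetterAB} (hw : w ∈ Leq) :
    ∃ k ≤ 5 * (w.length + 1),
      (automaton e he he').EndsRound w k (Pi.single (scanA, 0) 1) e 0 (1 - e) := by
  obtain ⟨i, hi⟩ := hw
  have hlen : w.length = i + i := by simp [hi]
  exact endsRound_of_count he he' hi (k := 1 + (w.length + i)) (by omega)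
    (endsRound_together he he')

lemma endsRound_of_notMem {w : List LetterAB} (hw : w ∉ Leq) :
    ∃ k ≤ 5 * (w.length + 1),
      (automaton e he he').EndsRound w k (Pi.single (scanA, 0) 1) 0 1 0 ∨
      (automaton e he he').EndsRound w k (Pi.single (scanA, 0) 1)
        (e / 2) (1 / 2) ((1 - e) / 2) := by
  obtain ⟨i, j, hij | ⟨r, hr⟩⟩ := exists_replicate_append w
  · have hne : i ≠ j := fun h => hw ⟨i, by rw [hij, h]⟩
    have hlen : w.length = i + j := by simp [hij]
    rcases hne.lt_or_gt with h | h
    · obtain ⟨k, hk, hends⟩ := endsRound_of_count he he' hij (k := 1 + (w.length + j)) (by omega)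
        (endsRound_goA_first he he' (by omega))
      exact ⟨k, hk, .inr hends⟩
    · obtain ⟨k, hk, hends⟩ := endsRound_of_count he he' hij (k := 1 + (w.length + i)) (by omega)
        (endsRound_goB_first he he' (by omega))
      exact ⟨k, hk, .inr hends⟩
  · obtain ⟨k, hk, hends⟩ := endsRound_malformed_word he he' i j r hr
    exact ⟨k, hk, .inl hends⟩

/-! ### Termination, error and expected time -/

lemma automaton_roundsTerminate : (automaton e he he').RoundsTerminate := by
  intro w q hq
  have hq : q = scanA := hq.elim id fun ⟨p, hp⟩ => automaton_isRestart he he' p q hp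
  subst hq
  by_cases hw : w ∈ Leq
  · obtain ⟨k, -, h⟩ := endsRound_of_mem he he' hw
    exact ⟨k, EndsRound.roundAt_eq_zero h le_rfl⟩
  · obtain ⟨k, -, h | h⟩ := endsRound_of_notMem he he' hw
    · exact ⟨k, EndsRound.roundAt_eq_zero h le_rfl⟩
    · exact ⟨k, EndsRound.roundAt_eq_zero h le_rfl⟩

lemma automaton_acceptProb {w : List LetterAB} (hw : w ∈ Leq) (h0 : 0 < e) :
    (automaton e he he').acceptProb w = 1 := by
  obtain ⟨k, -, h⟩ := endsRound_of_mem he he' hw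
  rw [EndsRound.acceptProb_eq h (automaton_isRestart he he') (by linarith), sub_sub_cancel,
    div_self h0.ne', ENNReal.ofReal_one]

lemma automaton_rejectProb {w : List LetterAB} (hw : w ∉ Leq) :
    ENNReal.ofReal (1 - e) ≤ (automaton e he he').rejectProb w := by
  obtain ⟨k, -, h | h⟩ := endsRound_of_notMem he he' hw
  · rw [EndsRound.rejectProb_eq h (automaton_isRestart he he') (by linarith)]
    exact ENNReal.ofReal_le_ofReal (by norm_num; exact he)
  · rw [EndsRound.rejectProb_eq h (automaton_isRestart he he') (by linarith)]
    refine ENNReal.ofReal_le_ofReal ?_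
    -- Since `1 - (1-e)/2 = (1+e)/2`, the claim is `(1-e)(1+e) ≤ 1`.
    rw [le_div_iff₀ (by linarith)]
    nlinarith [sq_nonneg e]

lemma automaton_expectedTime_le (h0 : 0 < e) (w : List LetterAB) :
    (automaton e he he').expectedTime w ≤
      ENNReal.ofReal (10 * (1 / e) * ((w.length : ℝ) + 1)) := by
  -- The restart probability is `1 - e`, `0` or `(1-e)/2`, always at most `1 - e/2`; hence at most
  -- `2/e` expected rounds of at most `5(|w|+1)` steps.
  have key : ∀ {k : ℕ} {a b c : ℝ}, k ≤ 5 * (w.length + 1) →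
      (automaton e he he').EndsRound w k (Pi.single (scanA, 0) 1) a b c → c ≤ 1 - e / 2 →
      (automaton e he he').expectedTime w ≤
        ENNReal.ofReal (10 * (1 / e) * ((w.length : ℝ) + 1)) := by
    intro k a b c hk h hc
    refine (EndsRound.expectedTime_le h (automaton_isRestart he he') (by linarith)).trans
      (ENNReal.ofReal_le_ofReal ?_)
    have hk' : (k : ℝ) ≤ 5 * ((w.length : ℝ) + 1) := by exact_mod_cast hk
    calc (k : ℝ) / (1 - c) ≤ 5 * ((w.length : ℝ) + 1) / (e / 2) := by
          gcongr
          linarith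
      _ = 10 * (1 / e) * ((w.length : ℝ) + 1) := by field_simp; ring
  by_cases hw : w ∈ Leq
  · obtain ⟨k, hk, h⟩ := endsRound_of_mem he he' hw
    exact key hk h (by linarith)
  · obtain ⟨k, hk, h | h⟩ := endsRound_of_notMem he he' hw
    · exact key hk h (by linarith)
    · exact key hk h (by linarith)

end LeqAutomaton

theorem mainTheorem7 :
    ∃ (n : ℕ) (C : ℝ), ∀ ε : ℝ, 0 < ε →
      ∃ M : TwoWayQFAReset (Fin n) LetterAB,
        M.IsRestart ∧ M.RoundsTerminate ∧ M.RecognizesOneSided Leq ε ∧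
          ∀ w : List LetterAB,
            M.expectedTime w ≤ ENNReal.ofReal (C * max 1 (1 / ε) * ((w.length : ℝ) + 1)) := by
  refine ⟨10, 10, fun ε hε => ?_⟩
  -- The parameter must be a probability, so it is capped at `1`; this is where `max 1 (1/ε)` comes
  -- from.
  have he : 0 < min 1 ε := lt_min one_pos hε
  refine ⟨LeqAutomaton.automaton (min 1 ε) he.le (min_le_left _ _),
    LeqAutomaton.automaton_isRestart _ _, LeqAutomaton.automaton_roundsTerminate _ _,
    ⟨fun w hw => LeqAutomaton.automaton_acceptProb _ _ hw he, fun w hw => ?_⟩, fun w => ?_⟩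
  · refine le_trans (ENNReal.ofReal_le_ofReal ?_) (LeqAutomaton.automaton_rejectProb _ _ hw)
    linarith [min_le_right 1 ε]
  · refine (LeqAutomaton.automaton_expectedTime_le _ _ he w).trans (ENNReal.ofReal_le_ofReal ?_)
    gcongr
    rcases le_total 1 ε with h | h
    · rw [min_eq_left h]
      simp
    · rw [min_eq_right h]
      exact le_max_right _ _
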